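/- **Conventions.** $X$ and $Y$ are real locally convex Hausdorff topological vector spaces; the topological dual $X^*$ carries the weak-$*$ topology; $E$ stands for $X$, $Y$, $X^*$ or $X\oplus Y$. For $f\colon E\to[-\infty,+\infty]$: $\operatorname{dom}f=\{f<+\infty\}$; $f$ is *proper* if $-\infty\notin f(E)\neq\{+\infty\}$; $f$ is *convex* (resp. *lower semicontinuous*) if its epigraph $\{(x,\xi)\in E\times\mathbb R: f(x)\le\xi\}$ is convex (resp. closed); $\Gamma_0(E)$ is the set of proper lower semicontinuous convex functions; $\operatorname{cam}f$ is the set of continuous affine minorants of $f$; $f^{**}(x)=\sup_{a\in\operatorname{cam}f}a(x)$; $\breve f$ is the largest lower semicontinuous convex function majorized by $f$; and $(\operatorname{rec}f)(x)=\sup_{y\in\operatorname{dom}f}(f(x+y)-f(y))$ when $f$ is proper and convex. For $f\colon X\to[-\infty,+\infty]$ and $g\colon X^*\to[-\infty,+\infty]$ the conjugates are $$f^*(x^*)=\sup_{x\in X}\big(\langle x,x^*\rangle-f(x)\big),\qquad g^*(x)=\sup_{x^*\in X^*}\big(\langle x,x^*\rangle-g(x^*)\big).$$ $\iota_C$ is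 the indicator function of $C$ ($0$ on $C$, $+\infty$ off $C$), $\sigma_C(x)=\sup_{x^*\in C}\langle x,x^*\rangle$ for $C\subset X^*$, and $\overline{\operatorname{conv}}\,C$ is the closed convex hull of $C$. Let $f^{\vee}$ be equal to $f$ where $-\infty<f<0$ and to $+\infty$ elsewhere, let $f^{\wedge}$ be equal to $f$ where $0<f<+\infty$ and to $+\infty$ elsewhere, and set $f^{\blacktriangledown}=(f^{\vee})^{**}$ and $f^{\blacktriangle}=(f^{\wedge})^{**}$. For $\varphi\colon X\to[-\infty,+\infty]$, set $\varphi^{*\blacktriangledown *}=\big((\varphi^*)^{\blacktriangledown}\big)^*$ and $\varphi^{*\blacktriangle *}=\big((\varphi^*)^{\blacktriangle}\big)^*$. The *preperspective* of $\varphi\colon X\to[-\infty,+\infty]$ with respect to $s\colon Y\to[-\infty,+\infty]$ is the function $\varphi\ltimes s$ on $X\times Y$ equal to $s(y)\varphi(x/s(y))$ if $0<s(y)<+\infty$ and to $+\infty$ otherwise. The *perspective* $\varphi\mathbin{\ltimes\!\!\!\!\bullet}s$ is the largest lower semicontinuous convex function on $X\oplus Y$ minorizing $\varphi\ltimes s$.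 **Theorem.** Let $\varphi\colon X\to\,]-\infty,+\infty]$ be proper with $\operatorname{cam}\varphi\neq\varnothing$, let $s\colon Y\to[-\infty,+\infty]$ be such that $S=s^{-1}(]0,+\infty[)\neq\varnothing$, and suppose that $$(\varphi^*)^{-1}(]-\infty,0])\neq\varnothing\quad\text{or}\quad\operatorname{cam}(-s)^{\vee}\neq\varnothing.$$ Write $P=\varphi\mathbin{\ltimes\!\!\!\!\bullet}s$, $a(y)=s^{\blacktriangle}(y)$ and $b(y)=-(-s)^{\blacktriangledown}(y)$. Then the following hold. (i) $P\in\Gamma_0(X\oplus Y)$. Furthermore, for all $x\in X$ and $y\in Y$: (ii) Suppose that $\varphi^*(X^*)\subset\,]-\infty,0]\cup\{+\infty\}$ and $(\varphi^*)^{-1}(]-\infty,0[)\neq\varnothing$. Then $a(y)\in[0,+\infty]$ and $$P(x,y)=\begin{cases}a(y)\,\breve\varphi\big(x/a(y)\big),&0<a(y)<+\infty;\\(\operatorname{rec}\breve\varphi)(x),&a(y)=0;\\+\infty,&a(y)=+\infty.\end{cases}$$ (iii) Suppose that $\varphi^*(X^*)\subset\{0,+\infty\}$. Then $P(x,y)=(\operatorname{rec}\breve\varphi)(x)+\iota_{\overline{\operatorname{conv}}\,S}(y)$.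 (iv) Suppose that $\varphi^*(X^*)\subset[0,+\infty]$. (a) If $(\varphi^*)^{-1}(\{0\})\neq\varnothing$ and $\operatorname{cam}(-s)^\vee=\varnothing$, then $P(x,y)=\sigma_{(\varphi^*)^{-1}(\{0\})}(x)+\iota_{\overline{\operatorname{conv}}\,S}(y)$. (b) If $(\varphi^*)^{-1}(]0,+\infty[)\neq\varnothing$ and $\operatorname{cam}(-s)^\vee\neq\varnothing$, then $b(y)\in[0,+\infty[\,\cup\{-\infty\}$ and $$P(x,y)=\begin{cases}b(y)\,\breve\varphi\big(x/b(y)\big),&0<b(y)<+\infty;\\(\operatorname{rec}\breve\varphi)(x),&b(y)=0;\\+\infty,&b(y)=-\infty.\end{cases}$$ (v) Suppose that $(\varphi^*)^{-1}(]-\infty,0[)\neq\varnothing$ and $(\varphi^*)^{-1}(]0,+\infty[)\neq\varnothing$. (a) $P(x,y)=\max\big\{(\varphi^{*\blacktriangledown *}\mathbin{\ltimes\!\!\!\!\bullet}s)(x,y),\,(\varphi^{*\blacktriangle *}\mathbin{\ltimes\!\!\!\!\bullet}s)(x,y)\big\}$. (b) If $\operatorname{cam}(-s)^\vee=\varnothing$,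 then $\varphi^{*\blacktriangledown *}\mathbin{\ltimes\!\!\!\!\bullet}s\ge\varphi^{*\blacktriangle *}\mathbin{\ltimes\!\!\!\!\bullet}s$ on $X\times Y$, $a(y)\in[0,+\infty]$, and $$P(x,y)=\begin{cases}a(y)\,\varphi^{*\blacktriangledown *}\big(x/a(y)\big),&0<a(y)<+\infty;\\(\operatorname{rec}\varphi^{*\blacktriangledown *})(x),&a(y)=0;\\+\infty,&a(y)=+\infty.\end{cases}$$ (c) If $\operatorname{cam}(-s)^\vee\neq\varnothing$, then $b(y)<+\infty$, $b(y)>0$ whenever $0<a(y)<+\infty$, and $$P(x,y)=\begin{cases}\max\big\{a(y)\,\varphi^{*\blacktriangledown *}\big(x/a(y)\big),\;b(y)\,\varphi^{*\blacktriangle *}\big(x/b(y)\big)\big\},&0<a(y)<+\infty;\\\max\big\{(\operatorname{rec}\varphi^{*\blacktriangledown *})(x),\;b(y)\,\varphi^{*\blacktriangle *}\big(x/b(y)\big)\big\},&a(y)=0<b(y);\\(\operatorname{rec}\breve\varphi)(x),&a(y)=0=b(y);\\+\infty,&\text{otherwise}.\end{cases}$$ -/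

import Mathlib

noncomputable section

namespace Persp

/-- Epigraph `{(x, ξ) ∈ E × ℝ | f x ≤ ξ}` of an extended-real-valued function. -/
def epi {E : Type*} (f : E → EReal) : Set (E × ℝ) := {p | f p.1 ≤ (p.2 : EReal)}

/-- Domain `{x | f x < +∞}`. -/
def edom {E : Type*} (f : E → EReal) : Set E := {x | f x < ⊤}

/-- `f` is proper: it never takes the value `-∞` and is not identically `+∞`. -/
def IsProper {E : Type*} (f : E → EReal) : Prop := (∀ x, f x ≠ ⊥) ∧ ∃ x, f x ≠ ⊤

/-- `f : E → [-∞, +∞]` is convex: its epigraph is convex. -/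
def IsConvexFun {E : Type*} [AddCommGroup E] [Module ℝ E] (f : E → EReal) : Prop :=
  Convex ℝ (epi f)

/-- Lower semicontinuity agrees with closedness of the epigraph. -/
theorem lowerSemicontinuous_iff_isClosed_epi {E : Type*} [TopologicalSpace E] (f : E → EReal) :
    LowerSemicontinuous f ↔ IsClosed (epi f) := by
  constructor
  · intro h
    have h1 := h.isClosed_epigraph
    have h2 : Continuous (fun p : E × ℝ => (p.1, (p.2 : EReal))) :=
      continuous_fst.prodMk (continuous_coe_real_ereal.comp continuous_snd)
    exact h1.preimage h2
  · intro h
    have key : ∀ r : ℝ, IsClosed {x | f x ≤ (r : EReal)} := fun r =>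
      h.preimage (f := fun x : E => (x, r)) (by fun_prop)
    rw [lowerSemicontinuous_iff_isClosed_preimage]
    intro y
    induction y with
    | bot =>
      have : f ⁻¹' Set.Iic ⊥ = ⋂ r : ℝ, {x | f x ≤ (r : EReal)} := by
        ext x
        simp only [Set.mem_preimage, Set.mem_Iic, Set.mem_iInter, Set.mem_ofPred_eq]
        constructor
        · intro hx r
          exact hx.trans bot_le
        · intro hx
          rw [le_bot_iff, EReal.eq_bot_iff_forall_lt]
          intro r
          refine lt_of_le_of_lt (hx (r - 1)) ?_
          exact_mod_cast sub_one_lt r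
      rw [this]
      exact isClosed_iInter key
    | coe r => exact key r
    | top => simp

/-- The class `Γ₀(E)` of proper lower semicontinuous convex functions. -/
structure GammaZero {E : Type*} [AddCommGroup E] [Module ℝ E] [TopologicalSpace E]
    (f : E → EReal) : Prop where
  proper : IsProper f
  lsc : LowerSemicontinuous f
  convex : IsConvexFun f

/-- `cam f`: the set of continuous affine minorants of `f`. -/
def cam {E : Type*} [AddCommGroup E] [Module ℝ E] [TopologicalSpace E] [IsTopologicalAddGroup E]
    (f : E → EReal) : Set (E →ᴬ[ℝ] ℝ) := {a | ∀ x, ((a x : ℝ) : EReal) ≤ f x}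

/-- `f**`: pointwise supremum of the continuous affine minorants of `f`
(identically `-∞` if there are none). -/
def biconj {E : Type*} [AddCommGroup E] [Module ℝ E] [TopologicalSpace E]
    [IsTopologicalAddGroup E] (f : E → EReal) (x : E) : EReal :=
  ⨆ a ∈ cam f, ((a x : ℝ) : EReal)

/-- `f˘`: the largest lower semicontinuous convex function majorized by `f`, as the pointwise
supremum of all such functions (see `lscConvexEnvelope_isGreatest`). -/
def lscConvexEnvelope {E : Type*} [AddCommGroup E] [Module ℝ E] [TopologicalSpace E]
    (f : E → EReal) (x : E) : EReal :=
  ⨆ g ∈ {g : E → EReal | LowerSemicontinuous g ∧ IsConvexFun g ∧ g ≤ f}, g x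

theorem lscConvexEnvelope_isGreatest {E : Type*} [AddCommGroup E] [Module ℝ E]
    [TopologicalSpace E] (f : E → EReal) :
    IsGreatest {g : E → EReal | LowerSemicontinuous g ∧ IsConvexFun g ∧ g ≤ f}
      (lscConvexEnvelope f) := by
  refine ⟨⟨?_, ?_, ?_⟩, ?_⟩
  · exact lowerSemicontinuous_biSup fun g hg => hg.1
  · have : epi (lscConvexEnvelope f) =
        ⋂ g ∈ {g : E → EReal | LowerSemicontinuous g ∧ IsConvexFun g ∧ g ≤ f}, epi g := by
      ext p
      simp only [epi, lscConvexEnvelope, Set.mem_ofPred_eq, iSup_le_iff, Set.mem_iInter]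
    rw [IsConvexFun, this]
    exact convex_iInter₂ fun g hg => hg.2.1
  · intro x
    exact iSup₂_le fun g hg => hg.2.2 x
  · intro g hg x
    exact le_iSup₂ (f := fun (g : E → EReal)
      (_ : g ∈ {g : E → EReal | LowerSemicontinuous g ∧ IsConvexFun g ∧ g ≤ f}) => g x) g hg

section Conjugates

variable {X : Type*} [AddCommGroup X] [Module ℝ X] [TopologicalSpace X]

/-- Conjugate `f* : X* → [-∞, +∞]` of `f : X → [-∞, +∞]`; the dual `X*` carries the weak-star
topology. -/
def conj (f : X → EReal) (u : WeakDual ℝ X) : EReal := ⨆ x : X, ((u x : ℝ) : EReal) - f x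

/-- Conjugate `g* : X → [-∞, +∞]` of `g : X* → [-∞, +∞]`. -/
def conjDual (g : WeakDual ℝ X → EReal) (x : X) : EReal :=
  ⨆ u : WeakDual ℝ X, ((u x : ℝ) : EReal) - g u

/-- Support function on `X` of a subset `C` of the dual `X*`. -/
def supportFun (C : Set (WeakDual ℝ X)) (x : X) : EReal := ⨆ u ∈ C, ((u x : ℝ) : EReal)

end Conjugates

open Classical in
/-- Indicator function: `0` on `C` and `+∞` elsewhere. -/
def indicatorFun {E : Type*} (C : Set E) (x : E) : EReal := if x ∈ C then 0 else ⊤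

/-- Recession function `x ↦ sup_{y ∈ dom f} (f (x + y) - f y)` of a proper convex function. -/
def recFun {E : Type*} [AddCommGroup E] (f : E → EReal) (x : E) : EReal :=
  ⨆ y ∈ edom f, f (x + y) - f y

open Classical in
/-- `f^∨`: equal to `f` where `-∞ < f < 0`, and to `+∞` elsewhere. -/
def negPart {E : Type*} (f : E → EReal) (x : E) : EReal :=
  if ⊥ < f x ∧ f x < 0 then f x else ⊤

open Classical in
/-- `f^∧`: equal to `f` where `0 < f < +∞`, and to `+∞` elsewhere. -/
def posPart {E : Type*} (f : E → EReal) (x : E) : EReal :=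
  if 0 < f x ∧ f x < ⊤ then f x else ⊤

/-- The `▼` envelope `(f^∨)**`. -/
def downEnv {E : Type*} [AddCommGroup E] [Module ℝ E] [TopologicalSpace E]
    [IsTopologicalAddGroup E] (f : E → EReal) : E → EReal := biconj (negPart f)

/-- The `▲` envelope `(f^∧)**`. -/
def upEnv {E : Type*} [AddCommGroup E] [Module ℝ E] [TopologicalSpace E]
    [IsTopologicalAddGroup E] (f : E → EReal) : E → EReal := biconj (posPart f)

/-- The function `φ^{*▼*}` (Huber-type part of `φ`); the `▼` envelope is taken on the dual with
its weak-star topology. -/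
def huberPart {X : Type*} [AddCommGroup X] [Module ℝ X] [TopologicalSpace X]
    (φ : X → EReal) : X → EReal := conjDual (downEnv (conj φ))

/-- The function `φ^{*▲*}` (Berhu-type part of `φ`). -/
def berhuPart {X : Type*} [AddCommGroup X] [Module ℝ X] [TopologicalSpace X]
    (φ : X → EReal) : X → EReal := conjDual (upEnv (conj φ))

/-- `r φ(x / r)`; only used for extended reals `r` with `0 < r < +∞`. -/
def scaled {X : Type*} [AddCommGroup X] [Module ℝ X] (r : EReal) (φ : X → EReal) (x : X) : EReal :=
  r * φ (r.toReal⁻¹ • x)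

open Classical in
/-- The preperspective of `φ` with respect to the scaling function `s`. -/
def preperspective {X Y : Type*} [AddCommGroup X] [Module ℝ X] (φ : X → EReal) (s : Y → EReal)
    (p : X × Y) : EReal :=
  if 0 < s p.2 ∧ s p.2 < ⊤ then scaled (s p.2) φ p.1 else ⊤

/-- The perspective of `φ` with respect to `s`: the largest lower semicontinuous convex function
on `X × Y` minorizing the preperspective. -/
def perspective {X Y : Type*} [AddCommGroup X] [Module ℝ X] [TopologicalSpace X]
    [AddCommGroup Y] [Module ℝ Y] [TopologicalSpace Y]
    (φ : X → EReal) (s : Y → EReal) : X × Y → EReal :=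
  lscConvexEnvelope (preperspective φ s)

end Persp

end

/-!
The perspective is a lower semicontinuous convex function with a continuous affine minorant, hence
by Hahn–Banach (`lscConvexEnvelope_eq_biconj`) the supremum of the continuous affine minorants of
the preperspective. Such a minorant has the form `(x, y) ↦ u x + w y` with `u ∈ X*` and `w`
continuous affine on `Y`. Minimizing over `x` for fixed `y`, it is a minorant exactly when
`m = φ* u` is finite and `w ≤ -m s` on `S = {0 < s < +∞}`. This yields the formula
(`perspective_eq_iSup`)

  `P(x, y) = sup {u x + Q_m(y) | φ* u = m ∈ ℝ}`,

in which `Q_m` (`scaleEnv s m`) is the supremum of the continuous affine minorants of `-m s` on `S`.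
By homogeneity `Q_m` is `-m s^▲` for `m < 0`, the indicator function of the closed convex hull of
`S` for `m = 0`, and `m (-s)^▼` for `m > 0`.

All the functions on the right-hand sides are suprema of affine functions of the same kind: the
envelope of `φ` is the supremum of `u - m` over the graph of `φ*` (`biconj_eq_affSup`), and
`φ^{*▼*}`, `φ^{*▲*}` are the suprema over the parts of the graph with `m < 0` and `m > 0`
(`huberPart_eq_affSup`, `berhuPart_eq_affSup`). For `m < 0` the points with `m = 0` may be added by
convexity of `φ*` (`affSup_nonpos_eq_affSup_neg`). Scaling such a supremum by `α > 0` multiplies `m`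
by `α` (`scaled_affSup`), and taking its recession function replaces `m` by `0` (`recFun_affSup`).
The formulas then follow by comparing suprema, according to the values of `s^▲` and `(-s)^▼` at `y`.
-/

noncomputable section

namespace Persp

/-! ### Suprema of extended reals -/

theorem coe_add_iSup {ι : Sort*} (r : ℝ) (f : ι → EReal) :
    (r : EReal) + ⨆ i, f i = ⨆ i, (r : EReal) + f i := by
  refine le_antisymm ?_ (iSup_le fun i => by gcongr; exact le_iSup f i)
  rw [add_comm, ← EReal.le_sub_iff_add_le (.inl (EReal.coe_ne_bot r)) (.inl (EReal.coe_ne_top r))]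
  refine iSup_le fun i => ?_
  rw [EReal.le_sub_iff_add_le (.inl (EReal.coe_ne_bot r)) (.inl (EReal.coe_ne_top r)), add_comm]
  exact le_iSup (fun i => (r : EReal) + f i) i

theorem coe_mul_iSup {ι : Sort*} {c : ℝ} (hc : 0 < c) (f : ι → EReal) :
    (c : EReal) * ⨆ i, f i = ⨆ i, (c : EReal) * f i := by
  have hc' : (0 : EReal) < c := by exact_mod_cast hc
  have hle : ∀ a b : EReal, a ≤ b / c ↔ c * a ≤ b := fun a b => by
    rw [EReal.le_div_iff_mul_le hc' (EReal.coe_ne_top c), mul_comm]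
  refine le_antisymm ?_ (iSup_le fun i => ?_)
  · rw [← hle]
    refine iSup_le fun i => ?_
    rw [hle]
    exact le_iSup (fun i => (c : EReal) * f i) i
  · exact mul_le_mul_of_nonneg_left (le_iSup f i) hc'.le

/-! ### Separation in locally convex spaces -/

section Separation

variable {E : Type*} [AddCommGroup E] [Module ℝ E] [TopologicalSpace E]

/-- The continuous affine function `x ↦ ℓ x + c`. -/
def affineOf (ℓ : E →L[ℝ] ℝ) (c : ℝ) : E →ᴬ[ℝ] ℝ :=
  ℓ.toContinuousAffineMap + ContinuousAffineMap.const ℝ E c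

@[simp] theorem affineOf_apply (ℓ : E →L[ℝ] ℝ) (c : ℝ) (x : E) : affineOf ℓ c x = ℓ x + c := rfl

theorem lowerSemicontinuous_coe_affine (a : E →ᴬ[ℝ] ℝ) :
    LowerSemicontinuous fun x => ((a x : ℝ) : EReal) :=
  (continuous_coe_real_ereal.comp a.continuous).lowerSemicontinuous

theorem isConvexFun_coe_affine (a : E →ᴬ[ℝ] ℝ) : IsConvexFun fun x => ((a x : ℝ) : EReal) := by
  intro p hp q hq α β hα hβ hαβ
  simp only [epi, Set.mem_ofPred_eq, EReal.coe_le_coe_iff] at hp hq ⊢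
  have := Convex.combo_affine_apply (f := (a : E →ᵃ[ℝ] ℝ)) (x := p.1) (y := q.1) hαβ
  simp only [ContinuousAffineMap.coe_toAffineMap] at this
  simp only [Prod.fst_add, Prod.smul_fst, Prod.snd_add, Prod.smul_snd, this, smul_eq_mul]
  gcongr

theorem lscConvexEnvelope_mono {f g : E → EReal} (h : f ≤ g) :
    lscConvexEnvelope f ≤ lscConvexEnvelope g :=
  let H := (lscConvexEnvelope_isGreatest f).1
  (lscConvexEnvelope_isGreatest g).2 ⟨H.1, H.2.1, H.2.2.trans h⟩

theorem affine_nonpos_of_mem_closedConvexHull {S : Set E} {y : E} (hy : y ∈ closedConvexHull ℝ S)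
    (w : E →ᴬ[ℝ] ℝ) (hw : ∀ z ∈ S, w z ≤ 0) : w y ≤ 0 := by
  have hc : Convex ℝ (w ⁻¹' Set.Iic 0) := (convex_Iic (0 : ℝ)).affine_preimage (w : E →ᵃ[ℝ] ℝ)
  exact closedConvexHull_min (t := w ⁻¹' Set.Iic 0) hw hc (isClosed_Iic.preimage w.continuous) hy

variable [IsTopologicalAddGroup E]

theorem affine_eq_contLinear_add (a : E →ᴬ[ℝ] ℝ) (x : E) : a x = a.contLinear x + a 0 := by
  have := congrFun a.decomp x
  simpa using this

theorem affine_le_lscConvexEnvelope {f : E → EReal} {a : E →ᴬ[ℝ] ℝ} (ha : a ∈ cam f) (x : E) :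
    ((a x : ℝ) : EReal) ≤ lscConvexEnvelope f x :=
  (lscConvexEnvelope_isGreatest f).2
    ⟨lowerSemicontinuous_coe_affine a, isConvexFun_coe_affine a, ha⟩ x

theorem gammaZero_lscConvexEnvelope {f : E → EReal} (hne : ∃ x, f x ≠ ⊤)
    (hcam : (cam f).Nonempty) : GammaZero (lscConvexEnvelope f) := by
  obtain ⟨hl, hc, hle⟩ := (lscConvexEnvelope_isGreatest f).1
  refine ⟨⟨fun x hx => ?_, hne.imp fun x hx => ne_top_of_le_ne_top hx (hle x)⟩, hl, hc⟩
  obtain ⟨a, ha⟩ := hcam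
  have := affine_le_lscConvexEnvelope ha x
  rw [hx, le_bot_iff] at this
  exact EReal.coe_ne_bot _ this

variable [ContinuousSMul ℝ E] [LocallyConvexSpace ℝ E]

theorem exists_affine_pos_of_notMem_closedConvexHull {S : Set E} {y : E}
    (hy : y ∉ closedConvexHull ℝ S) : ∃ w : E →ᴬ[ℝ] ℝ, (∀ z ∈ S, w z ≤ 0) ∧ 0 < w y := by
  obtain ⟨ℓ, c, h1, h2⟩ :=
    geometric_hahn_banach_closed_point convex_closedConvexHull isClosed_closedConvexHull hy
  refine ⟨affineOf ℓ (-c), fun z hz => ?_, ?_⟩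
  · have := h1 z (subset_closedConvexHull hz)
    simp only [affineOf_apply]; linarith
  · simp only [affineOf_apply]; linarith

/-- A lower semicontinuous convex function with a continuous affine minorant, not identically
`+∞`, is the supremum of its continuous affine minorants. A point strictly below the graph is
separated from the epigraph; a vertical separating hyperplane `h = 0` is made
non-vertical by adding large multiples of `h` to the given minorant `a₀`. -/
theorem le_biconj_of_lsc_of_convex {g : E → EReal} (hlsc : LowerSemicontinuous g)
    (hconv : IsConvexFun g) (hne : ∃ x, g x ≠ ⊤) (hcam : (cam g).Nonempty) (x : E) :
    g x ≤ biconj g x := by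
  obtain ⟨a₀, ha₀⟩ := hcam
  refine le_of_forall_lt fun t ht => ?_
  obtain ⟨r, htr, hr⟩ := EReal.lt_iff_exists_real_btwn.1 ht
  refine htr.trans ?_
  suffices ∃ a ∈ cam g, r < a x by
    obtain ⟨a, ha, har⟩ := this
    refine lt_of_lt_of_le (b := ((a x : ℝ) : EReal)) (by exact_mod_cast har) ?_
    exact le_iSup₂ (f := fun (a : E →ᴬ[ℝ] ℝ) (_ : a ∈ cam g) => ((a x : ℝ) : EReal)) a ha
  have hnot : (x, r) ∉ epi g := by simpa [epi] using hr
  obtain ⟨F, c, h1, h2⟩ := geometric_hahn_banach_point_closed hconv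
    ((lowerSemicontinuous_iff_isClosed_epi g).1 hlsc) hnot
  set ℓ : E →L[ℝ] ℝ := F.comp (ContinuousLinearMap.inl ℝ E ℝ) with hℓ
  set k : ℝ := F (0, 1) with hk
  have hF : ∀ z ξ, F (z, ξ) = ℓ z + ξ * k := fun z ξ => by
    have : ((z, ξ) : E × ℝ) = (z, 0) + ξ • (0, 1) := by simp
    rw [this, map_add, map_smul]; simp [hℓ, hk]
  have h2' : ∀ z (ξ : ℝ), g z ≤ ξ → c < ℓ z + ξ * k := fun z ξ hz => by
    rw [← hF]; exact h2 (z, ξ) hz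
  rw [hF] at h1
  have hbot : ∀ z, g z ≠ ⊥ := fun z hz => by
    have := ha₀ z
    rw [hz, le_bot_iff] at this
    exact EReal.coe_ne_bot _ this
  obtain ⟨x₀, hx₀⟩ := hne
  -- The epigraph is nonempty and unbounded upwards.
  have hk0 : 0 ≤ k := by
    by_contra! hneg
    lift g x₀ to ℝ using ⟨hx₀, hbot x₀⟩ with γ hγ
    have := h2' x₀ (max γ ((c - ℓ x₀) / k)) (by rw [← hγ]; exact_mod_cast le_max_left _ _)
    have h3 : max γ ((c - ℓ x₀) / k) * k ≤ (c - ℓ x₀) / k * k :=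
      mul_le_mul_of_nonpos_right (le_max_right _ _) hneg.le
    rw [div_mul_cancel₀ _ hneg.ne] at h3
    linarith
  rcases hk0.eq_or_lt with hk0 | hk0
  · rw [← hk0] at h1 h2'
    set δ := c - ℓ x with hδ
    have hδ0 : 0 < δ := by linarith
    set n := max 0 ((r + 1 - a₀ x) / δ) with hn
    refine ⟨a₀ + n • affineOf (-ℓ) c, fun z => ?_, ?_⟩
    · by_cases hz : g z = ⊤
      · rw [hz]; exact le_top
      have hz' := ha₀ z
      lift g z to ℝ using ⟨hz, hbot z⟩ with γ hγ
      have h3 := h2' z γ (by rw [← hγ])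
      have h4 : n * (-ℓ z + c) ≤ 0 :=
        mul_nonpos_of_nonneg_of_nonpos (le_max_left _ _) (by linarith)
      have h5 : a₀ z ≤ γ := by exact_mod_cast hz'
      simp only [ContinuousAffineMap.add_apply, ContinuousAffineMap.smul_apply, affineOf_apply,
        neg_apply, smul_eq_mul, EReal.coe_le_coe_iff]
      linarith
    · have : (r + 1 - a₀ x) / δ * δ ≤ n * δ := by gcongr; exact le_max_right _ _
      rw [div_mul_cancel₀ _ hδ0.ne'] at this
      simp only [ContinuousAffineMap.add_apply, ContinuousAffineMap.smul_apply, affineOf_apply,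
        neg_apply, smul_eq_mul]
      have h6 : -ℓ x + c = δ := by rw [hδ]; ring
      rw [h6]; linarith
  · refine ⟨affineOf (-k⁻¹ • ℓ) (c / k), fun z => ?_, ?_⟩
    · by_cases hz : g z = ⊤
      · rw [hz]; exact le_top
      lift g z to ℝ using ⟨hz, hbot z⟩ with γ hγ
      have h3 := h2' z γ (by rw [← hγ])
      have h4 : -k⁻¹ * ℓ z + c / k = (c - ℓ z) / k := by field_simp; ring
      simp only [affineOf_apply, smul_apply, smul_eq_mul, h4,
        EReal.coe_le_coe_iff]
      rw [div_le_iff₀ hk0]; linarith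
    · have h4 : -k⁻¹ * ℓ x + c / k = (c - ℓ x) / k := by field_simp; ring
      simp only [affineOf_apply, smul_apply, smul_eq_mul, h4]
      rw [lt_div_iff₀ hk0]; linarith

theorem lscConvexEnvelope_eq_biconj {f : E → EReal} (hne : ∃ x, f x ≠ ⊤)
    (hcam : (cam f).Nonempty) : lscConvexEnvelope f = biconj f := by
  obtain ⟨hl, hc, hle⟩ := (lscConvexEnvelope_isGreatest f).1
  funext x
  refine le_antisymm ?_ (iSup₂_le fun a ha => affine_le_lscConvexEnvelope ha x)
  obtain ⟨x₀, hx₀⟩ := hne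
  refine (le_biconj_of_lsc_of_convex hl hc ⟨x₀, ?_⟩ ?_ x).trans ?_
  · exact ne_top_of_le_ne_top hx₀ (hle x₀)
  · exact hcam.imp fun a ha z => affine_le_lscConvexEnvelope ha z
  · exact biSup_mono fun a ha z => (ha z).trans (hle z)

end Separation

/-! ### Conjugates and suprema of affine functions -/

theorem coe_sub_le_coe_iff (a r : ℝ) (b : EReal) :
    (a : EReal) - b ≤ r ↔ ((a - r : ℝ) : EReal) ≤ b := by
  rw [EReal.sub_le_iff_le_add (.inr (EReal.coe_ne_top r)) (.inr (EReal.coe_ne_bot r)), add_comm,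
    ← EReal.sub_le_iff_le_add (.inl (EReal.coe_ne_bot r)) (.inl (EReal.coe_ne_top r)),
    EReal.coe_sub]

section AffSup

variable {X : Type*} [AddCommGroup X] [Module ℝ X] [TopologicalSpace X]

/-- The supremum of the affine functions `x ↦ u x - m`, `(u, m) ∈ G`. -/
def affSup (G : Set (WeakDual ℝ X × ℝ)) (x : X) : EReal :=
  ⨆ p ∈ G, ((p.1 x - p.2 : ℝ) : EReal)

/-- The graph of the conjugate of `φ` over the points where it is finite. -/
def conjGraph (φ : X → EReal) : Set (WeakDual ℝ X × ℝ) := {p | conj φ p.1 = p.2}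

theorem conj_le_coe_iff (φ : X → EReal) (u : WeakDual ℝ X) (m : ℝ) :
    conj φ u ≤ m ↔ ∀ x, ((u x - m : ℝ) : EReal) ≤ φ x := by
  simp only [conj, iSup_le_iff, coe_sub_le_coe_iff]

theorem conjDual_le_coe_iff (g : WeakDual ℝ X → EReal) (x : X) (m : ℝ) :
    conjDual g x ≤ m ↔ ∀ u : WeakDual ℝ X, ((u x - m : ℝ) : EReal) ≤ g u := by
  simp only [conjDual, iSup_le_iff, coe_sub_le_coe_iff]

theorem le_of_mem_conjGraph {φ : X → EReal} {p : WeakDual ℝ X × ℝ} (hp : p ∈ conjGraph φ)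
    (x : X) : ((p.1 x - p.2 : ℝ) : EReal) ≤ φ x :=
  (conj_le_coe_iff φ p.1 p.2).1 (le_of_eq hp) x

theorem affSup_ne_top {φ : X → EReal} {G : Set (WeakDual ℝ X × ℝ)} (hG : G ⊆ conjGraph φ)
    (hφ : ∃ x, φ x ≠ ⊤) : ∃ x, affSup G x ≠ ⊤ :=
  hφ.imp fun x hx =>
    ne_top_of_le_ne_top hx (iSup₂_le fun _ hp => le_of_mem_conjGraph (hG hp) x)

theorem affSup_le {φ : X → EReal} {G : Set (WeakDual ℝ X × ℝ)} (hG : G ⊆ conjGraph φ) :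
    affSup G ≤ φ :=
  fun x => iSup₂_le fun _ hp => le_of_mem_conjGraph (hG hp) x

theorem le_affSup {G : Set (WeakDual ℝ X × ℝ)} {p : WeakDual ℝ X × ℝ} (hp : p ∈ G) (x : X) :
    ((p.1 x - p.2 : ℝ) : EReal) ≤ affSup G x :=
  le_iSup₂ (f := fun (p : WeakDual ℝ X × ℝ) (_ : p ∈ G) => ((p.1 x - p.2 : ℝ) : EReal)) p hp

theorem conj_ne_bot {φ : X → EReal} (hφ : ∃ x, φ x ≠ ⊤) (u : WeakDual ℝ X) : conj φ u ≠ ⊥ := by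
  obtain ⟨x, hx⟩ := hφ
  intro h
  have h1 : ((u x : ℝ) : EReal) - φ x ≤ conj φ u := le_iSup (fun x => ((u x : ℝ) : EReal) - φ x) x
  rw [h, le_bot_iff] at h1
  induction hv : φ x with
  | bot => rw [hv] at h1; simp at h1
  | top => exact hx hv
  | coe r => rw [hv, ← EReal.coe_sub] at h1; exact EReal.coe_ne_bot _ h1

theorem exists_conj_eq_coe {φ : X → EReal} (hφ : ∃ x, φ x ≠ ⊤) {u : WeakDual ℝ X}
    (hu : conj φ u ≠ ⊤) : ∃ m : ℝ, conj φ u = m :=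
  ⟨_, (EReal.coe_toReal hu (conj_ne_bot hφ u)).symm⟩

/-- Evaluation at `x`, shifted by `-r`, is weak-star continuous and affine; hence passing to the
biconjugate on the dual does not change the conjugate. -/
theorem conjDual_biconj (g : WeakDual ℝ X → EReal) : conjDual (biconj g) = conjDual g := by
  funext x
  refine eq_of_forall_ge_iff fun c => ?_
  suffices H : ∀ r : ℝ, conjDual (biconj g) x ≤ r ↔ conjDual g x ≤ r by
    constructor
    · intro h
      refine EReal.le_of_forall_lt_iff_le.1 fun r hr => ?_
      exact (H r).1 (h.trans hr.le)
    · intro h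
      refine EReal.le_of_forall_lt_iff_le.1 fun r hr => ?_
      exact (H r).2 (h.trans hr.le)
  intro r
  rw [conjDual_le_coe_iff, conjDual_le_coe_iff]
  constructor
  · exact fun h u => (h u).trans (iSup₂_le fun a ha => ha u)
  · intro h u
    let ℓ : WeakDual ℝ X →L[ℝ] ℝ :=
      { toFun := fun u => u x
        map_add' := fun _ _ => rfl
        map_smul' := fun _ _ => rfl
        cont := WeakDual.eval_continuous x }
    have hmem : affineOf ℓ (-r) ∈ cam g := fun v => by
      have := h v
      rwa [sub_eq_add_neg] at this
    have := le_iSup₂ (f := fun (a : WeakDual ℝ X →ᴬ[ℝ] ℝ) (_ : a ∈ cam g) =>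
      ((a u : ℝ) : EReal)) _ hmem
    rwa [sub_eq_add_neg]

theorem huberPart_eq_affSup {φ : X → EReal} (hφ : ∃ x, φ x ≠ ⊤) :
    huberPart φ = affSup {p ∈ conjGraph φ | p.2 < 0} := by
  funext x
  rw [huberPart, downEnv, conjDual_biconj]
  refine le_antisymm (iSup_le fun u => ?_) (iSup₂_le fun p hp => ?_)
  · rw [negPart]
    split_ifs with hu
    · obtain ⟨m, hm⟩ := exists_conj_eq_coe hφ (ne_top_of_lt hu.2)
      rw [hm, ← EReal.coe_sub]
      rw [hm] at hu
      exact le_affSup (G := {p ∈ conjGraph φ | p.2 < 0}) (p := (u, m))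
        ⟨hm, by exact_mod_cast hu.2⟩ x
    · simp
  · obtain ⟨u, m⟩ := p
    obtain ⟨hm, hneg⟩ := hp
    have hm : conj φ u = m := hm
    refine le_trans (le_of_eq ?_) (le_iSup (fun u => ((u x : ℝ) : EReal) - negPart (conj φ) u) u)
    have : ⊥ < conj φ u ∧ conj φ u < 0 := by
      rw [hm]; exact ⟨EReal.bot_lt_coe m, by exact_mod_cast hneg⟩
    rw [negPart, if_pos this, hm, ← EReal.coe_sub]

theorem berhuPart_eq_affSup {φ : X → EReal} (hφ : ∃ x, φ x ≠ ⊤) :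
    berhuPart φ = affSup {p ∈ conjGraph φ | 0 < p.2} := by
  funext x
  rw [berhuPart, upEnv, conjDual_biconj]
  refine le_antisymm (iSup_le fun u => ?_) (iSup₂_le fun p hp => ?_)
  · rw [posPart]
    split_ifs with hu
    · obtain ⟨m, hm⟩ := exists_conj_eq_coe hφ hu.2.ne
      rw [hm, ← EReal.coe_sub]
      rw [hm] at hu
      exact le_affSup (G := {p ∈ conjGraph φ | 0 < p.2}) (p := (u, m))
        ⟨hm, by exact_mod_cast hu.1⟩ x
    · simp
  · obtain ⟨u, m⟩ := p
    obtain ⟨hm, hpos⟩ := hp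
    have hm : conj φ u = m := hm
    refine le_trans (le_of_eq ?_) (le_iSup (fun u => ((u x : ℝ) : EReal) - posPart (conj φ) u) u)
    have : 0 < conj φ u ∧ conj φ u < ⊤ := by
      rw [hm]; exact ⟨by exact_mod_cast hpos, EReal.coe_lt_top m⟩
    rw [posPart, if_pos this, hm, ← EReal.coe_sub]

/-- Once `φ*` is negative somewhere, its zeros do not contribute to the supremum of the affine
functions with `φ* u < 0`: on the segment from `u` with `φ* u = 0` to a point of negativity, `φ*`
is negative except at `u`. -/
theorem affSup_nonpos_eq_affSup_neg {φ : X → EReal} (hφ : ∃ x, φ x ≠ ⊤)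
    (hneg : ∃ p ∈ conjGraph φ, p.2 < 0) :
    affSup {p ∈ conjGraph φ | p.2 ≤ 0} = affSup {p ∈ conjGraph φ | p.2 < 0} := by
  funext x
  refine le_antisymm (iSup₂_le fun p hp => ?_)
    (iSup₂_le fun p hp => le_affSup (G := {p ∈ conjGraph φ | p.2 ≤ 0}) ⟨hp.1, hp.2.le⟩ x)
  obtain ⟨⟨v, n⟩, hv, hn⟩ := hneg
  obtain ⟨u, m⟩ := p
  obtain ⟨hu, hm⟩ := hp
  simp only at hn hm ⊢
  refine EReal.le_of_forall_lt_iff_le.1 fun r hr => ?_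
  rw [EReal.coe_le_coe_iff]
  have key : ∀ t : ℝ, 0 < t → t < 1 → (1 - t) * (u x - m) + t * (v x - n) ≤ r := by
    intro t ht0 ht1
    have hw : conj φ ((1 - t) • u + t • v) ≤ (((1 - t) * m + t * n : ℝ) : EReal) := by
      rw [conj_le_coe_iff]
      intro z
      have h1 := le_of_mem_conjGraph hu z
      have h2 := le_of_mem_conjGraph hv z
      induction hz : φ z with
      | bot => rw [hz, le_bot_iff] at h1; exact absurd h1 (EReal.coe_ne_bot _)
      | top => exact le_top
      | coe c =>
        rw [hz, EReal.coe_le_coe_iff] at h1 h2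
        rw [EReal.coe_le_coe_iff]
        change (1 - t) * u z + t * v z - _ ≤ c
        simp only at h1 h2
        nlinarith
    obtain ⟨k, hk⟩ := exists_conj_eq_coe hφ (ne_top_of_le_ne_top (EReal.coe_ne_top _) hw)
    rw [hk, EReal.coe_le_coe_iff] at hw
    have hk0 : k < 0 := by nlinarith
    have h3 := (le_affSup (G := {p ∈ conjGraph φ | p.2 < 0})
      (p := ((1 - t) • u + t • v, k)) ⟨hk, hk0⟩ x).trans hr.le
    rw [EReal.coe_le_coe_iff] at h3
    change (1 - t) * u x + t * v x - k ≤ r at h3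
    nlinarith
  have hlim : Filter.Tendsto (fun t : ℝ => (1 - t) * (u x - m) + t * (v x - n))
      (nhdsWithin 0 (Set.Ioi 0)) (nhds (u x - m)) := by
    have : Continuous fun t : ℝ => (1 - t) * (u x - m) + t * (v x - n) := by fun_prop
    have h := this.tendsto 0
    simp only [sub_zero, one_mul, zero_mul, add_zero] at h
    exact h.mono_left nhdsWithin_le_nhds
  refine le_of_tendsto hlim ?_
  filter_upwards [Ioo_mem_nhdsGT (zero_lt_one' ℝ)] with t ht
  exact key t ht.1 ht.2

theorem scaled_affSup {α : ℝ} (hα : 0 < α) (G : Set (WeakDual ℝ X × ℝ)) (x : X) :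
    scaled (α : EReal) (affSup G) x = ⨆ p ∈ G, ((p.1 x - α * p.2 : ℝ) : EReal) := by
  simp only [scaled, affSup, EReal.toReal_coe, coe_mul_iSup hα, ← EReal.coe_mul, map_smul,
    smul_eq_mul, mul_sub, mul_inv_cancel_left₀ hα.ne']

/-- The recession function of a supremum of affine functions is the supremum of their linear
parts. If `f (y + x) ≤ f y + r` throughout `dom f`, then `f (y + n x) ≤ f y + n r`, so that the
slope of every affine minorant in the direction `x` is at most `r`. -/
theorem recFun_affSup {G : Set (WeakDual ℝ X × ℝ)} (hG : G.Nonempty)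
    (hdom : ∃ x, affSup G x ≠ ⊤) (x : X) :
    recFun (affSup G) x = ⨆ p ∈ G, ((p.1 x : ℝ) : EReal) := by
  have hbot : ∀ z, affSup G z ≠ ⊥ := fun z hz => by
    obtain ⟨p, hp⟩ := hG
    have := le_affSup hp z
    rw [hz, le_bot_iff] at this
    exact EReal.coe_ne_bot _ this
  refine le_antisymm (iSup₂_le fun y hy => ?_) (iSup₂_le fun p hp => ?_)
  · have hy' : affSup G y ≠ ⊤ := ne_top_of_lt hy
    rw [EReal.sub_le_iff_le_add (.inl (hbot y)) (.inl hy')]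
    refine iSup₂_le fun p hp => ?_
    have : ((p.1 (x + y) - p.2 : ℝ) : EReal) = ((p.1 x : ℝ) : EReal) +
        ((p.1 y - p.2 : ℝ) : EReal) := by
      rw [← EReal.coe_add, map_add, add_sub_assoc]
    rw [this]
    gcongr
    · exact le_iSup₂ (f := fun (p : WeakDual ℝ X × ℝ) (_ : p ∈ G) => ((p.1 x : ℝ) : EReal)) p hp
    · exact le_affSup hp y
  · refine EReal.le_of_forall_lt_iff_le.1 fun r hr => ?_
    rw [EReal.coe_le_coe_iff]
    have step : ∀ y, affSup G y ≠ ⊤ → affSup G (x + y) ≤ (r : EReal) + affSup G y := fun y hy => by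
      rw [← EReal.sub_le_iff_le_add (.inl (hbot y)) (.inl hy)]
      refine le_trans ?_ hr.le
      exact le_iSup₂ (f := fun (y : X) (_ : y ∈ edom (affSup G)) =>
        affSup G (x + y) - affSup G y) y (lt_top_iff_ne_top.2 hy)
    obtain ⟨y, hy⟩ := hdom
    obtain ⟨γ, hγ⟩ : ∃ γ : ℝ, affSup G y = γ := ⟨_, (EReal.coe_toReal hy (hbot y)).symm⟩
    have hn : ∀ n : ℕ, affSup G (n • x + y) ≤ ((n * r + γ : ℝ) : EReal) := by
      intro n
      induction n with
      | zero => simp [hγ]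
      | succ n ih =>
        have h1 := step (n • x + y) (ne_top_of_le_ne_top (EReal.coe_ne_top _) ih)
        have h2 : (n + 1) • x + y = x + (n • x + y) := by rw [succ_nsmul']; abel
        rw [h2]
        refine h1.trans ((add_le_add_right ih _).trans (le_of_eq ?_))
        rw [← EReal.coe_add]
        congr 1
        push_cast
        ring
    by_contra! hlt
    obtain ⟨n, hn'⟩ := exists_nat_gt ((γ - (p.1 y - p.2)) / (p.1 x - r))
    have h3 := (le_affSup hp (n • x + y)).trans (hn n)
    rw [EReal.coe_le_coe_iff, map_add, map_nsmul, nsmul_eq_mul] at h3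
    rw [div_lt_iff₀ (by linarith)] at hn'
    nlinarith

variable [IsTopologicalAddGroup X]

theorem exists_mem_conjGraph_of_mem_cam {φ : X → EReal} (hφ : ∃ x, φ x ≠ ⊤) {a : X →ᴬ[ℝ] ℝ}
    (ha : a ∈ cam φ) :
    ∃ p ∈ conjGraph φ, ∀ x, a x ≤ p.1 x - p.2 := by
  set u : WeakDual ℝ X := a.contLinear
  have hax : ∀ x, a x = u x + a 0 := affine_eq_contLinear_add a
  have h1 : conj φ u ≤ ((-a 0 : ℝ) : EReal) := by
    rw [conj_le_coe_iff]
    intro x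
    have := ha x
    rwa [hax, ← sub_neg_eq_add] at this
  obtain ⟨m, hm⟩ := exists_conj_eq_coe hφ (ne_top_of_le_ne_top (EReal.coe_ne_top _) h1)
  refine ⟨(u, m), hm, fun x => ?_⟩
  rw [hm, EReal.coe_le_coe_iff] at h1
  rw [hax]; linarith

theorem biconj_eq_affSup {φ : X → EReal} (hφ : ∃ x, φ x ≠ ⊤) :
    biconj φ = affSup (conjGraph φ) := by
  funext x
  refine le_antisymm (iSup₂_le fun a ha => ?_) (iSup₂_le fun p hp => ?_)
  · obtain ⟨p, hp, hle⟩ := exists_mem_conjGraph_of_mem_cam hφ ha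
    exact (EReal.coe_le_coe_iff.2 (hle x)).trans (le_affSup hp x)
  · have hmem : affineOf (p.1 : X →L[ℝ] ℝ) (-p.2) ∈ cam φ := fun z => by
      have := le_of_mem_conjGraph hp z
      rwa [sub_eq_add_neg] at this
    have := le_iSup₂ (f := fun (a : X →ᴬ[ℝ] ℝ) (_ : a ∈ cam φ) => ((a x : ℝ) : EReal)) _ hmem
    rwa [sub_eq_add_neg]

end AffSup

/-! ### Envelopes of the scaling function -/

theorem exists_pos_coe_of_mem_Ioo {b : EReal} (hb : b ∈ Set.Ioo 0 ⊤) :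
    ∃ σ : ℝ, 0 < σ ∧ b = σ := by
  obtain ⟨σ, rfl⟩ : ∃ σ : ℝ, b = σ :=
    ⟨_, (EReal.coe_toReal hb.2.ne (EReal.bot_lt_zero.trans hb.1).ne').symm⟩
  exact ⟨σ, by exact_mod_cast hb.1, rfl⟩

section Scaling

variable {Y : Type*} [AddCommGroup Y] [Module ℝ Y] [TopologicalSpace Y]

/-- The continuous affine functions `w` on `Y` with `w ≤ -m s` wherever `0 < s < +∞`. -/
def scaleMinorants (s : Y → EReal) (m : ℝ) : Set (Y →ᴬ[ℝ] ℝ) :=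
  {w | ∀ z, ∀ σ : ℝ, 0 < σ → s z = σ → w z ≤ -(m * σ)}

/-- The supremum of the continuous affine minorants of `-m s` on `{0 < s < +∞}`. For `m = -1` it
is `s^▲`, for `m = 1` it is `(-s)^▼`, and for `m = 0` it is the indicator function of the closed
convex hull of `{0 < s < +∞}`. -/
def scaleEnv (s : Y → EReal) (m : ℝ) (y : Y) : EReal :=
  ⨆ w ∈ scaleMinorants s m, ((w y : ℝ) : EReal)

theorem le_scaleEnv {s : Y → EReal} {m : ℝ} {w : Y →ᴬ[ℝ] ℝ} (hw : w ∈ scaleMinorants s m)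
    (y : Y) : ((w y : ℝ) : EReal) ≤ scaleEnv s m y :=
  le_iSup₂ (f := fun (w : Y →ᴬ[ℝ] ℝ) (_ : w ∈ scaleMinorants s m) => ((w y : ℝ) : EReal)) w hw

theorem smul_mem_scaleMinorants {s : Y → EReal} {c m : ℝ} (hc : 0 ≤ c) {w : Y →ᴬ[ℝ] ℝ}
    (hw : w ∈ scaleMinorants s m) : c • w ∈ scaleMinorants s (c * m) := by
  intro z σ hσ hz
  have := mul_le_mul_of_nonneg_left (hw z σ hσ hz) hc
  rw [ContinuousAffineMap.smul_apply, smul_eq_mul]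
  linarith

theorem zero_mem_scaleMinorants (s : Y → EReal) {m : ℝ} (hm : m ≤ 0) :
    0 ∈ scaleMinorants s m := by
  intro z σ hσ _
  rw [ContinuousAffineMap.zero_apply]
  nlinarith

theorem scaleEnv_mul (s : Y → EReal) {c : ℝ} (hc : 0 < c) (m : ℝ) (y : Y) :
    scaleEnv s (c * m) y = c * scaleEnv s m y := by
  simp only [scaleEnv, coe_mul_iSup hc]
  refine le_antisymm (iSup₂_le fun w hw => ?_) (iSup₂_le fun w hw => ?_)
  · have h1 := smul_mem_scaleMinorants (inv_nonneg.2 hc.le) hw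
    rw [inv_mul_cancel_left₀ hc.ne'] at h1
    refine le_trans (le_of_eq ?_) (le_iSup₂ (f := fun (w : Y →ᴬ[ℝ] ℝ)
      (_ : w ∈ scaleMinorants s m) => (c : EReal) * ((w y : ℝ) : EReal)) _ h1)
    rw [← EReal.coe_mul, ContinuousAffineMap.smul_apply, smul_eq_mul, mul_inv_cancel_left₀ hc.ne']
  · have := le_scaleEnv (smul_mem_scaleMinorants hc.le hw) y
    rwa [ContinuousAffineMap.smul_apply, smul_eq_mul, EReal.coe_mul] at this

theorem scaleEnv_nonneg (s : Y → EReal) {m : ℝ} (hm : m ≤ 0) (y : Y) : 0 ≤ scaleEnv s m y := by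
  simpa using le_scaleEnv (zero_mem_scaleMinorants s hm) y

theorem scaleEnv_one_add_le {s : Y → EReal} {y : Y}
    (hy : y ∈ closedConvexHull ℝ (s ⁻¹' Set.Ioo 0 ⊤)) {w : Y →ᴬ[ℝ] ℝ}
    (hw : w ∈ scaleMinorants s (-1)) : scaleEnv s 1 y ≤ ((-w y : ℝ) : EReal) := by
  refine iSup₂_le fun v hv => ?_
  rw [EReal.coe_le_coe_iff]
  have := affine_nonpos_of_mem_closedConvexHull hy (v + w) fun z hz => by
    obtain ⟨σ, hpos, hσ⟩ := exists_pos_coe_of_mem_Ioo hz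
    have h1 := hv z σ hpos hσ
    have h2 := hw z σ hpos hσ
    rw [ContinuousAffineMap.add_apply]
    linarith
  rw [ContinuousAffineMap.add_apply] at this
  linarith

theorem scaleEnv_one_nonpos {s : Y → EReal} {y : Y}
    (hy : y ∈ closedConvexHull ℝ (s ⁻¹' Set.Ioo 0 ⊤)) : scaleEnv s 1 y ≤ 0 := by
  simpa using scaleEnv_one_add_le hy (zero_mem_scaleMinorants s (by norm_num))

/-- On the closed convex hull of `{0 < s < +∞}`, `s^▲ ≤ -(-s)^▼`. -/
theorem scaleEnv_neg_one_le {s : Y → EReal} {y : Y}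
    (hy : y ∈ closedConvexHull ℝ (s ⁻¹' Set.Ioo 0 ⊤)) : scaleEnv s (-1) y ≤ -scaleEnv s 1 y := by
  refine iSup₂_le fun w hw => ?_
  rw [EReal.le_neg, ← EReal.coe_neg]
  exact scaleEnv_one_add_le hy hw

theorem scaleEnv_eq_top_of_neg {s : Y → EReal} {m : ℝ} (hm : m < 0) {y : Y}
    (h : scaleEnv s (-1) y = ⊤) : scaleEnv s m y = ⊤ := by
  have := scaleEnv_mul s (neg_pos.2 hm) (-1) y
  rw [neg_mul_neg, mul_one] at this
  rw [this, h, EReal.coe_mul_top_of_pos (neg_pos.2 hm)]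

theorem scaleEnv_eq_top_of_pos {s : Y → EReal} {m : ℝ} (hm : 0 < m) {y : Y}
    (h : scaleEnv s 1 y = ⊤) : scaleEnv s m y = ⊤ := by
  have := scaleEnv_mul s hm 1 y
  rw [mul_one] at this
  rw [this, h, EReal.coe_mul_top_of_pos hm]

variable [IsTopologicalAddGroup Y]

theorem cam_posPart (s : Y → EReal) : cam (posPart s) = scaleMinorants s (-1) := by
  ext w
  refine ⟨fun h z σ hσ hz => ?_, fun h z => ?_⟩
  · have := h z
    have hs : 0 < s z ∧ s z < ⊤ := by
      rw [hz]; exact ⟨by exact_mod_cast hσ, EReal.coe_lt_top σ⟩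
    rw [posPart, if_pos hs, hz, EReal.coe_le_coe_iff] at this
    linarith
  · rw [posPart]
    split_ifs with hs
    · obtain ⟨σ, hpos, hσ⟩ := exists_pos_coe_of_mem_Ioo hs
      have := h z σ hpos hσ
      rw [hσ, EReal.coe_le_coe_iff]
      linarith
    · exact le_top

theorem cam_negPart_neg (s : Y → EReal) : cam (negPart (-s)) = scaleMinorants s 1 := by
  ext w
  refine ⟨fun h z σ hσ hz => ?_, fun h z => ?_⟩
  · have := h z
    have hs : ⊥ < (-s) z ∧ (-s) z < 0 := by
      rw [Pi.neg_apply, hz, ← EReal.coe_neg]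
      exact ⟨EReal.bot_lt_coe _, by exact_mod_cast neg_neg_of_pos hσ⟩
    rw [negPart, if_pos hs, Pi.neg_apply, hz, ← EReal.coe_neg, EReal.coe_le_coe_iff] at this
    linarith
  · rw [negPart]
    split_ifs with hs
    · obtain ⟨σ, hσ⟩ : ∃ σ : ℝ, (-s) z = σ :=
        ⟨_, (EReal.coe_toReal (ne_top_of_lt hs.2) hs.1.ne').symm⟩
      have hσ' : s z = ((-σ : ℝ) : EReal) := by
        rw [EReal.coe_neg, ← hσ, Pi.neg_apply, neg_neg]
      rw [hσ] at hs ⊢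
      have hneg : σ < 0 := by exact_mod_cast hs.2
      have := h z (-σ) (by linarith) hσ'
      rw [EReal.coe_le_coe_iff]
      linarith
    · exact le_top

theorem upEnv_eq_scaleEnv (s : Y → EReal) : upEnv s = scaleEnv s (-1) := by
  funext y
  rw [upEnv, biconj, scaleEnv, cam_posPart]

theorem downEnv_neg_eq_scaleEnv (s : Y → EReal) : downEnv (-s) = scaleEnv s 1 := by
  funext y
  rw [downEnv, biconj, scaleEnv, cam_negPart_neg]

variable [ContinuousSMul ℝ Y] [LocallyConvexSpace ℝ Y]

/-- Off the closed convex hull of `{0 < s < +∞}`, adding large multiples of a separating affine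
function to one minorant shows that the envelope is infinite. -/
theorem scaleEnv_eq_top {s : Y → EReal} {m : ℝ} (hne : (scaleMinorants s m).Nonempty) {y : Y}
    (hy : y ∉ closedConvexHull ℝ (s ⁻¹' Set.Ioo 0 ⊤)) : scaleEnv s m y = ⊤ := by
  obtain ⟨v, hv, hvy⟩ := exists_affine_pos_of_notMem_closedConvexHull hy
  obtain ⟨w, hw⟩ := hne
  rw [EReal.eq_top_iff_forall_lt]
  intro r
  set t := max 0 ((r + 1 - w y) / v y) with ht
  have hmem : w + t • v ∈ scaleMinorants s m := by
    intro z σ hσ hz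
    have h1 := hw z σ hσ hz
    have h2 : v z ≤ 0 := hv z (by
      rw [Set.mem_preimage, hz]
      exact ⟨by exact_mod_cast hσ, EReal.coe_lt_top σ⟩)
    have h3 : t * v z ≤ 0 := mul_nonpos_of_nonneg_of_nonpos (le_max_left _ _) h2
    rw [ContinuousAffineMap.add_apply, ContinuousAffineMap.smul_apply, smul_eq_mul]
    linarith
  refine lt_of_lt_of_le ?_ (le_scaleEnv hmem y)
  rw [EReal.coe_lt_coe_iff, ContinuousAffineMap.add_apply, ContinuousAffineMap.smul_apply,
    smul_eq_mul]
  have : (r + 1 - w y) / v y * v y ≤ t * v y := by gcongr; exact le_max_right _ _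
  rw [div_mul_cancel₀ _ hvy.ne'] at this
  linarith

theorem scaleEnv_zero (s : Y → EReal) (y : Y) :
    scaleEnv s 0 y = indicatorFun (closedConvexHull ℝ (s ⁻¹' Set.Ioo 0 ⊤)) y := by
  rw [indicatorFun]
  split_ifs with hy
  · refine le_antisymm (iSup₂_le fun w hw => ?_) (scaleEnv_nonneg s le_rfl y)
    have := affine_nonpos_of_mem_closedConvexHull hy w fun z hz => by
      obtain ⟨σ, hpos, hσ⟩ := exists_pos_coe_of_mem_Ioo hz
      simpa using hw z σ hpos hσ
    exact_mod_cast this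
  · exact scaleEnv_eq_top ⟨0, zero_mem_scaleMinorants s le_rfl⟩ hy

/-- The closed convex hull of `{0 < s < +∞}` contains the domain of `s^▲`, which is
nonnegative. -/
theorem scaleEnv_neg_one_cases (s : Y → EReal) (y : Y) :
    scaleEnv s (-1) y = ⊤ ∨ ∃ α : ℝ, 0 ≤ α ∧ scaleEnv s (-1) y = α ∧
      y ∈ closedConvexHull ℝ (s ⁻¹' Set.Ioo 0 ⊤) := by
  have h0 := scaleEnv_nonneg s (m := -1) (by norm_num) y
  have hne : (scaleMinorants s (-1)).Nonempty := ⟨0, zero_mem_scaleMinorants s (by norm_num)⟩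
  by_cases ht : scaleEnv s (-1) y = ⊤
  · exact .inl ht
  refine .inr ⟨(scaleEnv s (-1) y).toReal, EReal.toReal_nonneg h0,
    (EReal.coe_toReal ht (EReal.bot_lt_zero.trans_le h0).ne').symm, ?_⟩
  by_contra hy
  exact ht (scaleEnv_eq_top hne hy)

/-- If `(-s)^∨` has a continuous affine minorant, then `(-s)^▼` is real and nonpositive on the
closed convex hull of `{0 < s < +∞}` and infinite, together with `s^▲`, off it. -/
theorem scaleEnv_one_cases {s : Y → EReal} (hne : (scaleMinorants s 1).Nonempty) (y : Y) :
    scaleEnv s 1 y = ⊤ ∧ scaleEnv s (-1) y = ⊤ ∨ ∃ β : ℝ, 0 ≤ β ∧ scaleEnv s 1 y = (-β : ℝ) ∧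
      y ∈ closedConvexHull ℝ (s ⁻¹' Set.Ioo 0 ⊤) := by
  by_cases hy : y ∈ closedConvexHull ℝ (s ⁻¹' Set.Ioo 0 ⊤)
  · have h0 := scaleEnv_one_nonpos hy
    obtain ⟨w, hw⟩ := hne
    have hbot : scaleEnv s 1 y ≠ ⊥ := ((EReal.bot_lt_coe _).trans_le (le_scaleEnv hw y)).ne'
    obtain ⟨γ, hγ⟩ : ∃ γ : ℝ, scaleEnv s 1 y = γ :=
      ⟨_, (EReal.coe_toReal (ne_top_of_le_ne_top EReal.zero_ne_top h0) hbot).symm⟩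
    refine .inr ⟨-γ, ?_, by rw [hγ, neg_neg], hy⟩
    rw [hγ] at h0
    have : γ ≤ 0 := by exact_mod_cast h0
    linarith
  · exact .inl ⟨scaleEnv_eq_top hne hy,
      scaleEnv_eq_top ⟨0, zero_mem_scaleMinorants s (by norm_num)⟩ hy⟩

theorem scaleEnv_of_nonpos {s : Y → EReal} {m α : ℝ} (hm : m ≤ 0) {y : Y}
    (hy : y ∈ closedConvexHull ℝ (s ⁻¹' Set.Ioo 0 ⊤)) (hα : scaleEnv s (-1) y = α) :
    scaleEnv s m y = ((-(α * m) : ℝ) : EReal) := by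
  rcases hm.eq_or_lt with rfl | hm
  · rw [scaleEnv_zero, indicatorFun, if_pos hy]; simp
  · have := scaleEnv_mul s (neg_pos.2 hm) (-1) y
    rw [neg_mul_neg, mul_one] at this
    rw [this, hα, ← EReal.coe_mul]
    congr 1; ring

theorem scaleEnv_of_nonneg {s : Y → EReal} {m β : ℝ} (hm : 0 ≤ m) {y : Y}
    (hy : y ∈ closedConvexHull ℝ (s ⁻¹' Set.Ioo 0 ⊤)) (hβ : scaleEnv s 1 y = (-β : ℝ)) :
    scaleEnv s m y = ((-(β * m) : ℝ) : EReal) := by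
  rcases hm.eq_or_lt with rfl | hm
  · rw [scaleEnv_zero, indicatorFun, if_pos hy]; simp
  · have := scaleEnv_mul s hm 1 y
    rw [mul_one] at this
    rw [this, hβ, ← EReal.coe_mul]
    congr 1; ring

end Scaling

/-! ### Affine minorants of the preperspective -/

theorem preperspective_mono {X Y : Type*} [AddCommGroup X] [Module ℝ X]
    {φ ψ : X → EReal} (h : φ ≤ ψ) (s : Y → EReal) :
    preperspective φ s ≤ preperspective ψ s := by
  intro p
  simp only [preperspective]
  split_ifs with hs
  · exact mul_le_mul_of_nonneg_left (h _) hs.1.le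
  · exact le_rfl

theorem exists_preperspective_ne_top {X Y : Type*} [AddCommGroup X] [Module ℝ X]
    {φ : X → EReal} (hφ : ∃ x, φ x ≠ ⊤) {s : Y → EReal}
    (hs : (s ⁻¹' Set.Ioo 0 ⊤).Nonempty) (hbot : ∀ x, φ x ≠ ⊥) :
    ∃ p, preperspective φ s p ≠ ⊤ := by
  obtain ⟨x, hx⟩ := hφ
  obtain ⟨y, hy⟩ := hs
  obtain ⟨σ, hσ, hsy⟩ := exists_pos_coe_of_mem_Ioo hy
  refine ⟨(σ • x, y), ?_⟩
  obtain ⟨γ, hγ⟩ : ∃ γ : ℝ, φ x = γ := ⟨_, (EReal.coe_toReal hx (hbot x)).symm⟩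
  have hy' : 0 < s y ∧ s y < ⊤ := hy
  rw [preperspective, if_pos hy', scaled, hsy, EReal.toReal_coe, inv_smul_smul₀ hσ.ne', hγ,
    ← EReal.coe_mul]
  exact EReal.coe_ne_top _

section Perspective

variable {X Y : Type*} [AddCommGroup X] [Module ℝ X] [TopologicalSpace X]
  [AddCommGroup Y] [Module ℝ Y] [TopologicalSpace Y]

/-- The continuous affine function `(x, y) ↦ u x + w y`. -/
def affineSum (u : WeakDual ℝ X) (w : Y →ᴬ[ℝ] ℝ) : X × Y →ᴬ[ℝ] ℝ :=
  ((u : X →L[ℝ] ℝ).comp (ContinuousLinearMap.fst ℝ X Y)).toContinuousAffineMap +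
    w.comp (ContinuousLinearMap.snd ℝ X Y).toContinuousAffineMap

@[simp] theorem affineSum_apply (u : WeakDual ℝ X) (w : Y →ᴬ[ℝ] ℝ) (p : X × Y) :
    affineSum u w p = u p.1 + w p.2 := rfl

theorem perspective_mono {φ ψ : X → EReal} (h : φ ≤ ψ) (s : Y → EReal) :
    perspective φ s ≤ perspective ψ s :=
  lscConvexEnvelope_mono (preperspective_mono h s)

variable [IsTopologicalAddGroup X] [IsTopologicalAddGroup Y]

theorem affineSum_mem_cam_preperspective {φ : X → EReal} {u : WeakDual ℝ X} {m : ℝ}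
    (hu : ∀ x, ((u x - m : ℝ) : EReal) ≤ φ x) {s : Y → EReal} {w : Y →ᴬ[ℝ] ℝ}
    (hw : w ∈ scaleMinorants s m) : affineSum u w ∈ cam (preperspective φ s) := by
  rintro ⟨x, y⟩
  rw [preperspective]
  split_ifs with hs
  · obtain ⟨σ, hσ, hsy⟩ := exists_pos_coe_of_mem_Ioo hs
    have h1 := hw y σ hσ hsy
    simp only at hsy
    rw [scaled, hsy, EReal.toReal_coe]
    refine le_trans ?_ (mul_le_mul_of_nonneg_left (hu (σ⁻¹ • x)) (by exact_mod_cast hσ.le))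
    rw [← EReal.coe_mul, EReal.coe_le_coe_iff, map_smul, smul_eq_mul, mul_sub,
      mul_inv_cancel_left₀ hσ.ne', affineSum_apply]
    linarith
  · exact le_top

/-- Every continuous affine minorant of the preperspective splits as `u x + w y` with `φ* u`
finite and `w ≤ -φ*(u) s`: for fixed `y`, minimizing over `x` produces the conjugate. -/
theorem exists_of_mem_cam_preperspective {φ : X → EReal} (hφ : ∃ x, φ x ≠ ⊤) {s : Y → EReal}
    (hs : (s ⁻¹' Set.Ioo 0 ⊤).Nonempty) {A : X × Y →ᴬ[ℝ] ℝ}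
    (hA : A ∈ cam (preperspective φ s)) :
    ∃ p ∈ conjGraph φ, ∃ w ∈ scaleMinorants s p.2, ∀ x y, A (x, y) = p.1 x + w y := by
  set u : WeakDual ℝ X := A.contLinear.comp (ContinuousLinearMap.inl ℝ X Y)
  set w : Y →ᴬ[ℝ] ℝ := A.comp (ContinuousLinearMap.inr ℝ X Y).toContinuousAffineMap
  have hA' : ∀ x y, A (x, y) = u x + w y := fun x y => by
    have h1 : w y = A (0, y) := rfl
    have h2 : u x = A.contLinear (x, 0) := rfl
    rw [h1, h2, affine_eq_contLinear_add A (x, y), affine_eq_contLinear_add A (0, y), ← add_assoc,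
      ← map_add]
    simp
  have key : ∀ y, ∀ σ : ℝ, 0 < σ → s y = σ → conj φ u ≤ ((-(w y / σ) : ℝ) : EReal) := by
    intro y σ hσ hsy
    rw [conj_le_coe_iff]
    intro x
    have h1 := hA (σ • x, y)
    have hs' : 0 < s y ∧ s y < ⊤ := by
      rw [hsy]; exact ⟨by exact_mod_cast hσ, EReal.coe_lt_top σ⟩
    rw [preperspective, if_pos hs', scaled, hsy, EReal.toReal_coe, inv_smul_smul₀ hσ.ne', hA',
      ← EReal.div_le_iff_le_mul (by exact_mod_cast hσ) (EReal.coe_ne_top σ),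
      ← EReal.coe_div, map_smul, smul_eq_mul, add_div, mul_div_cancel_left₀ _ hσ.ne'] at h1
    rwa [sub_neg_eq_add]
  obtain ⟨y₀, hy₀⟩ := hs
  obtain ⟨σ₀, hσ₀, hsy₀⟩ := exists_pos_coe_of_mem_Ioo hy₀
  obtain ⟨m, hm⟩ := exists_conj_eq_coe hφ
    (ne_top_of_le_ne_top (EReal.coe_ne_top _) (key y₀ σ₀ hσ₀ hsy₀))
  refine ⟨(u, m), hm, w, fun y σ hσ hsy => ?_, hA'⟩
  have h1 := key y σ hσ hsy
  rw [hm, EReal.coe_le_coe_iff, le_neg, div_le_iff₀ hσ] at h1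
  simpa using h1

/-- An affine minorant `u - m` of `φ` alone bounds the perspective from below; `m` need not be
`φ* u`, so that this applies to the perspectives of `φ^{*▼*}` and `φ^{*▲*}` without computing
their conjugates. -/
theorem add_scaleEnv_le_perspective {φ : X → EReal} {u : WeakDual ℝ X} {m : ℝ}
    (hu : ∀ x, ((u x - m : ℝ) : EReal) ≤ φ x) (s : Y → EReal) (x : X) (y : Y) :
    ((u x : ℝ) : EReal) + scaleEnv s m y ≤ perspective φ s (x, y) := by
  simp only [scaleEnv, coe_add_iSup]
  refine iSup₂_le fun w hw => ?_
  rw [← EReal.coe_add]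
  exact affine_le_lscConvexEnvelope (affineSum_mem_cam_preperspective hu hw) (x, y)

theorem cam_preperspective_nonempty {φ : X → EReal} (hφ : ∃ x, φ x ≠ ⊤) (hcam : (cam φ).Nonempty)
    {s : Y → EReal} (h : (∃ u, conj φ u ≤ 0) ∨ (cam (negPart (-s))).Nonempty) :
    (cam (preperspective φ s)).Nonempty := by
  have H : ∀ p ∈ conjGraph φ, p.2 ≤ 0 → (cam (preperspective φ s)).Nonempty := fun p hp hp0 =>
    ⟨_, affineSum_mem_cam_preperspective (le_of_mem_conjGraph hp) (zero_mem_scaleMinorants s hp0)⟩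
  rcases h with ⟨u, hu⟩ | ⟨w, hw⟩
  · obtain ⟨m, hm⟩ := exists_conj_eq_coe hφ (ne_top_of_le_ne_top EReal.zero_ne_top hu)
    exact H (u, m) hm (by rw [hm] at hu; exact_mod_cast hu)
  · obtain ⟨a, ha⟩ := hcam
    obtain ⟨p, hp, -⟩ := exists_mem_conjGraph_of_mem_cam hφ ha
    rcases le_total p.2 0 with hp0 | hp0
    · exact H p hp hp0
    · rw [cam_negPart_neg] at hw
      have := smul_mem_scaleMinorants hp0 hw
      rw [mul_one] at this
      exact ⟨_, affineSum_mem_cam_preperspective (le_of_mem_conjGraph hp) this⟩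

variable [ContinuousSMul ℝ X] [LocallyConvexSpace ℝ X]
  [ContinuousSMul ℝ Y] [LocallyConvexSpace ℝ Y]

/-- The dual formula for the perspective, obtained by taking the supremum over all continuous
affine minorants of the preperspective and grouping them by their linear part `u` on `X`. -/
theorem perspective_eq_iSup {φ : X → EReal} (hφ : IsProper φ) {s : Y → EReal}
    (hs : (s ⁻¹' Set.Ioo 0 ⊤).Nonempty) (hcam : (cam (preperspective φ s)).Nonempty)
    (x : X) (y : Y) :
    perspective φ s (x, y) = ⨆ p ∈ conjGraph φ, ((p.1 x : ℝ) : EReal) + scaleEnv s p.2 y := by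
  refine le_antisymm ?_
    (iSup₂_le fun p hp => add_scaleEnv_le_perspective (le_of_mem_conjGraph hp) s x y)
  rw [perspective, lscConvexEnvelope_eq_biconj (exists_preperspective_ne_top hφ.2 hs hφ.1) hcam]
  refine iSup₂_le fun A hA => ?_
  obtain ⟨p, hp, w, hw, hA'⟩ := exists_of_mem_cam_preperspective hφ.2 hs hA
  refine le_trans ?_ (le_iSup₂ (f := fun (p : WeakDual ℝ X × ℝ) (_ : p ∈ conjGraph φ) =>
    ((p.1 x : ℝ) : EReal) + scaleEnv s p.2 y) p hp)
  rw [hA', EReal.coe_add]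
  gcongr
  exact le_scaleEnv hw y

end Perspective

/-! ### Evaluation of the supremum -/

section Evaluation

variable {X Y : Type*} [AddCommGroup X] [Module ℝ X] [TopologicalSpace X]
  [AddCommGroup Y] [Module ℝ Y] [TopologicalSpace Y]

/-- The part of the perspective that comes from the points `(u, m) ∈ G` of the graph of `φ*`. -/
def partialPersp (G : Set (WeakDual ℝ X × ℝ)) (s : Y → EReal) (x : X) (y : Y) : EReal :=
  ⨆ p ∈ G, ((p.1 x : ℝ) : EReal) + scaleEnv s p.2 y

theorem partialPersp_eq_max (φ : X → EReal) (s : Y → EReal) (x : X) (y : Y) :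
    partialPersp (conjGraph φ) s x y = max (partialPersp {p ∈ conjGraph φ | p.2 ≤ 0} s x y)
      (partialPersp {p ∈ conjGraph φ | 0 < p.2} s x y) := by
  have : conjGraph φ = {p ∈ conjGraph φ | p.2 ≤ 0} ∪ {p ∈ conjGraph φ | 0 < p.2} := by
    ext p
    simp only [Set.mem_union, Set.mem_ofPred_eq, ← and_or_left, le_or_gt, and_true]
  conv_lhs => rw [partialPersp, this, iSup_union]
  rfl

theorem partialPersp_eq_top {G : Set (WeakDual ℝ X × ℝ)} {s : Y → EReal} {y : Y}
    {p : WeakDual ℝ X × ℝ} (hp : p ∈ G) (h : scaleEnv s p.2 y = ⊤) (x : X) :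
    partialPersp G s x y = ⊤ := by
  have := le_iSup₂ (f := fun (p : WeakDual ℝ X × ℝ) (_ : p ∈ G) =>
    ((p.1 x : ℝ) : EReal) + scaleEnv s p.2 y) p hp
  rw [h, EReal.coe_add_top, top_le_iff] at this
  exact this

theorem partialPersp_eq_iSup {G : Set (WeakDual ℝ X × ℝ)} {s : Y → EReal} {y : Y} {α : ℝ}
    (h : ∀ p ∈ G, scaleEnv s p.2 y = ((-(α * p.2) : ℝ) : EReal)) (x : X) :
    partialPersp G s x y = ⨆ p ∈ G, ((p.1 x - α * p.2 : ℝ) : EReal) := by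
  refine biSup_congr fun p hp => ?_
  rw [h p hp, ← EReal.coe_add, sub_eq_add_neg]

theorem partialPersp_eq_scaled {G : Set (WeakDual ℝ X × ℝ)} {s : Y → EReal} {y : Y} {α : ℝ}
    (hα : 0 < α) (h : ∀ p ∈ G, scaleEnv s p.2 y = ((-(α * p.2) : ℝ) : EReal)) (x : X) :
    partialPersp G s x y = scaled α (affSup G) x := by
  rw [partialPersp_eq_iSup h, scaled_affSup hα]

theorem partialPersp_eq_recFun {φ : X → EReal} (hφ : ∃ x, φ x ≠ ⊤) {G : Set (WeakDual ℝ X × ℝ)}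
    (hG : G ⊆ conjGraph φ) (hne : G.Nonempty) {s : Y → EReal} {y : Y}
    (h : ∀ p ∈ G, scaleEnv s p.2 y = 0) (x : X) :
    partialPersp G s x y = recFun (affSup G) x := by
  rw [recFun_affSup hne (affSup_ne_top hG hφ)]
  refine biSup_congr fun p hp => ?_
  rw [h p hp, add_zero]

/-- If `(-s)^∨` has no continuous affine minorant, the points with `φ* u > 0` do not
contribute: `scaleEnv s m y` is then a supremum over the empty set. -/
theorem partialPersp_eq_nonpos {s : Y → EReal} (hs : scaleMinorants s 1 = ∅) (φ : X → EReal)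
    (x : X) (y : Y) :
    partialPersp (conjGraph φ) s x y = partialPersp {p ∈ conjGraph φ | p.2 ≤ 0} s x y := by
  rw [partialPersp_eq_max, max_eq_left]
  refine iSup₂_le fun p hp => ?_
  have h1 : scaleEnv s 1 y = ⊥ := by rw [scaleEnv, hs]; simp
  have := scaleEnv_mul s hp.2 1 y
  rw [mul_one, h1, EReal.coe_mul_bot_of_pos hp.2] at this
  rw [this, EReal.add_bot]
  exact bot_le

theorem partialPersp_eq_add_indicatorFun [IsTopologicalAddGroup Y] [ContinuousSMul ℝ Y]
    [LocallyConvexSpace ℝ Y] {G : Set (WeakDual ℝ X × ℝ)} (hne : G.Nonempty)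
    (h : ∀ p ∈ G, p.2 = 0) (s : Y → EReal) (x : X) (y : Y) :
    partialPersp G s x y = (⨆ p ∈ G, ((p.1 x : ℝ) : EReal)) +
      indicatorFun (closedConvexHull ℝ (s ⁻¹' Set.Ioo 0 ⊤)) y := by
  rw [← scaleEnv_zero]
  by_cases hy : y ∈ closedConvexHull ℝ (s ⁻¹' Set.Ioo 0 ⊤)
  · have h0 : scaleEnv s 0 y = 0 := by rw [scaleEnv_zero, indicatorFun, if_pos hy]
    rw [h0, add_zero]
    refine biSup_congr fun p hp => ?_
    rw [h p hp, h0, add_zero]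
  · have h0 : scaleEnv s 0 y = ⊤ := by rw [scaleEnv_zero, indicatorFun, if_neg hy]
    obtain ⟨p, hp⟩ := hne
    rw [partialPersp_eq_top hp (by rw [h p hp, h0]), h0, EReal.add_top_of_ne_bot]
    refine ((EReal.bot_lt_coe (p.1 x)).trans_le ?_).ne'
    exact le_iSup₂ (f := fun (p : WeakDual ℝ X × ℝ) (_ : p ∈ G) => ((p.1 x : ℝ) : EReal)) p hp

end Evaluation

end Persp

end

/-! ### The formulas for the perspective -/

open Classical in
theorem theorem5p2
    {X : Type*} [AddCommGroup X] [Module ℝ X] [TopologicalSpace X] [IsTopologicalAddGroup X]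
    [ContinuousSMul ℝ X] [LocallyConvexSpace ℝ X] [T2Space X]
    {Y : Type*} [AddCommGroup Y] [Module ℝ Y] [TopologicalSpace Y] [IsTopologicalAddGroup Y]
    [ContinuousSMul ℝ Y] [LocallyConvexSpace ℝ Y] [T2Space Y]
    (φ : X → EReal) (hφ : Persp.IsProper φ) (hcam : (Persp.cam φ).Nonempty)
    (s : Y → EReal) (S : Set Y) (hS : S = s ⁻¹' Set.Ioo 0 ⊤) (hSne : S.Nonempty)
    (h : (∃ u, Persp.conj φ u ≤ 0) ∨ (Persp.cam (Persp.negPart (-s))).Nonempty) :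
    -- membership in Γ₀(X ⊕ Y)
    Persp.GammaZero (Persp.perspective φ s) ∧
    -- `φ*` has values in `]-∞, 0] ∪ {+∞}` and is negative somewhere
    ((∀ u, Persp.conj φ u ≤ 0 ∨ Persp.conj φ u = ⊤) → (∃ u, Persp.conj φ u < 0) →
      ∀ x y, 0 ≤ Persp.upEnv s y ∧
        Persp.perspective φ s (x, y) =
          if 0 < Persp.upEnv s y ∧ Persp.upEnv s y < ⊤ then
            Persp.scaled (Persp.upEnv s y) (Persp.lscConvexEnvelope φ) x
          else if Persp.upEnv s y = 0 then Persp.recFun (Persp.lscConvexEnvelope φ) x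
          else ⊤) ∧
    -- `φ*` has values in `{0, +∞}`
    ((∀ u, Persp.conj φ u = 0 ∨ Persp.conj φ u = ⊤) →
      ∀ x y, Persp.perspective φ s (x, y) =
        Persp.recFun (Persp.lscConvexEnvelope φ) x +
          Persp.indicatorFun (closedConvexHull ℝ S) y) ∧
    -- `φ*` has values in `[0, +∞]`
    ((∀ u, 0 ≤ Persp.conj φ u) →
      ((∃ u, Persp.conj φ u = 0) → Persp.cam (Persp.negPart (-s)) = ∅ →
        ∀ x y, Persp.perspective φ s (x, y) =
          Persp.supportFun {u | Persp.conj φ u = 0} x +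
            Persp.indicatorFun (closedConvexHull ℝ S) y) ∧
      ((∃ u, 0 < Persp.conj φ u ∧ Persp.conj φ u < ⊤) →
        (Persp.cam (Persp.negPart (-s))).Nonempty →
        ∀ x y,
          (⊥ < Persp.downEnv (-s) y ∧ (Persp.downEnv (-s) y ≤ 0 ∨ Persp.downEnv (-s) y = ⊤)) ∧
          Persp.perspective φ s (x, y) =
            if ⊥ < Persp.downEnv (-s) y ∧ Persp.downEnv (-s) y < 0 then
              Persp.scaled (-Persp.downEnv (-s) y) (Persp.lscConvexEnvelope φ) x
            else if Persp.downEnv (-s) y = 0 then Persp.recFun (Persp.lscConvexEnvelope φ) x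
            else ⊤)) ∧
    -- `φ*` takes negative values and positive real values
    ((∃ u, Persp.conj φ u < 0) → (∃ u, 0 < Persp.conj φ u ∧ Persp.conj φ u < ⊤) →
      (∀ x y, Persp.perspective φ s (x, y) =
        max (Persp.perspective (Persp.huberPart φ) s (x, y))
          (Persp.perspective (Persp.berhuPart φ) s (x, y))) ∧
      (Persp.cam (Persp.negPart (-s)) = ∅ →
        Persp.perspective (Persp.berhuPart φ) s ≤ Persp.perspective (Persp.huberPart φ) s ∧
        ∀ x y, 0 ≤ Persp.upEnv s y ∧
          Persp.perspective φ s (x, y) =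
            if 0 < Persp.upEnv s y ∧ Persp.upEnv s y < ⊤ then
              Persp.scaled (Persp.upEnv s y) (Persp.huberPart φ) x
            else if Persp.upEnv s y = 0 then Persp.recFun (Persp.huberPart φ) x
            else ⊤) ∧
      ((Persp.cam (Persp.negPart (-s))).Nonempty →
        ∀ x y,
          -- the scaling factors in the formula below are positive reals
          ⊥ < Persp.downEnv (-s) y ∧
          (0 < Persp.upEnv s y ∧ Persp.upEnv s y < ⊤ → Persp.downEnv (-s) y < 0) ∧
          Persp.perspective φ s (x, y) =
            if 0 < Persp.upEnv s y ∧ Persp.upEnv s y < ⊤ then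
              max (Persp.scaled (Persp.upEnv s y) (Persp.huberPart φ) x)
                (Persp.scaled (-Persp.downEnv (-s) y) (Persp.berhuPart φ) x)
            else if Persp.downEnv (-s) y < 0 ∧ Persp.upEnv s y = 0 then
              max (Persp.recFun (Persp.huberPart φ) x)
                (Persp.scaled (-Persp.downEnv (-s) y) (Persp.berhuPart φ) x)
            else if Persp.downEnv (-s) y = 0 ∧ Persp.upEnv s y = 0 then
              Persp.recFun (Persp.lscConvexEnvelope φ) x
            else ⊤)) := by
  subst hS
  have hφt := hφ.2
  have hcamP := Persp.cam_preperspective_nonempty hφt hcam h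
  set G := Persp.conjGraph φ with hG
  have hP : ∀ x y, Persp.perspective φ s (x, y) = Persp.partialPersp G s x y :=
    Persp.perspective_eq_iSup hφ hSne hcamP
  have hGne : G.Nonempty := by
    obtain ⟨a, ha⟩ := hcam
    obtain ⟨p, hp, -⟩ := Persp.exists_mem_conjGraph_of_mem_cam hφt ha
    exact ⟨p, hp⟩
  have henv : Persp.lscConvexEnvelope φ = Persp.affSup G := by
    rw [Persp.lscConvexEnvelope_eq_biconj hφt hcam, Persp.biconj_eq_affSup hφt]
  have hreal : ∀ u, Persp.conj φ u ≠ ⊤ → ∃ m : ℝ, Persp.conj φ u = m :=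
    fun u => Persp.exists_conj_eq_coe hφt
  have hnegG : (∃ u, Persp.conj φ u < 0) → ∃ p ∈ G, p.2 < 0 := by
    rintro ⟨u, hu⟩
    obtain ⟨m, hm⟩ := hreal u (ne_top_of_lt hu)
    exact ⟨(u, m), hm, by rw [hm] at hu; exact_mod_cast hu⟩
  have hposG : (∃ u, 0 < Persp.conj φ u ∧ Persp.conj φ u < ⊤) → ∃ p ∈ G, 0 < p.2 := by
    rintro ⟨u, hu, hu'⟩
    obtain ⟨m, hm⟩ := hreal u hu'.ne
    exact ⟨(u, m), hm, by rw [hm] at hu; exact_mod_cast hu⟩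
  have hGp : {p ∈ G | 0 < p.2} ⊆ G := fun p hp => hp.1
  have hGn : {p ∈ G | p.2 ≤ 0} ⊆ G := fun p hp => hp.1
  rw [Persp.upEnv_eq_scaleEnv, Persp.downEnv_neg_eq_scaleEnv, Persp.cam_negPart_neg, henv]
  refine ⟨Persp.gammaZero_lscConvexEnvelope
    (Persp.exists_preperspective_ne_top hφt hSne hφ.1) hcamP, ?_, ?_, ?_, ?_⟩
  · intro hle hneg x y
    refine ⟨Persp.scaleEnv_nonneg s (by norm_num) y, ?_⟩
    have hG0 : ∀ p ∈ G, p.2 ≤ 0 := fun p hp => by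
      have hp' : Persp.conj φ p.1 = p.2 := hp
      rcases hle p.1 with h1 | h1
      · rw [hp'] at h1; exact_mod_cast h1
      · rw [hp'] at h1; exact absurd h1 (EReal.coe_ne_top _)
    rw [hP]
    rcases Persp.scaleEnv_neg_one_cases s y with ha | ⟨α, hα, ha, hy⟩
    · obtain ⟨p, hp, hp0⟩ := hnegG hneg
      rw [Persp.partialPersp_eq_top hp (Persp.scaleEnv_eq_top_of_neg hp0 ha)]
      simp [ha]
    · have hQ := fun p (hp : p ∈ G) => Persp.scaleEnv_of_nonpos (hG0 p hp) hy ha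
      rw [ha]
      rcases hα.eq_or_lt with rfl | hα
      · rw [Persp.partialPersp_eq_recFun (G := G) hφt subset_rfl hGne fun p hp => by simp [hQ p hp]]
        simp
      · rw [Persp.partialPersp_eq_scaled hα hQ, if_pos]
        exact ⟨by exact_mod_cast hα, EReal.coe_lt_top α⟩
  · intro hz x y
    have hG0 : ∀ p ∈ G, p.2 = 0 := fun p hp => by
      have hp' : Persp.conj φ p.1 = p.2 := hp
      rcases hz p.1 with h1 | h1
      · rw [hp'] at h1; exact_mod_cast h1
      · rw [hp'] at h1; exact absurd h1 (EReal.coe_ne_top _)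
    rw [hP, Persp.recFun_affSup hGne (Persp.affSup_ne_top (φ := φ) subset_rfl hφt),
      Persp.partialPersp_eq_add_indicatorFun hGne hG0]
  · intro hnn
    have hG0 : ∀ p ∈ G, 0 ≤ p.2 := fun p hp => by
      have h1 := hnn p.1
      rw [show Persp.conj φ p.1 = p.2 from hp] at h1
      exact_mod_cast h1
    refine ⟨?_, ?_⟩
    · rintro ⟨u₀, hu₀⟩ hempty x y
      rw [hP, Persp.partialPersp_eq_nonpos hempty]
      -- As `φ* ≥ 0`, the part `m ≤ 0` of the graph is the zero set of `φ*`.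
      have hiff : ∀ p : WeakDual ℝ X × ℝ, p ∈ {p ∈ G | p.2 ≤ 0} ↔
          p.2 = 0 ∧ Persp.conj φ p.1 = 0 := fun p => by
        refine ⟨fun hp => ?_, fun hp => ⟨?_, hp.1.le⟩⟩
        · have h0 := le_antisymm hp.2 (hG0 p hp.1)
          refine ⟨h0, ?_⟩
          rw [show Persp.conj φ p.1 = p.2 from hp.1, h0, EReal.coe_zero]
        · change Persp.conj φ p.1 = p.2
          rw [hp.1, hp.2, EReal.coe_zero]
      have hsup : Persp.supportFun {u | Persp.conj φ u = 0} x =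
          ⨆ p ∈ {p ∈ G | p.2 ≤ 0}, ((p.1 x : ℝ) : EReal) := by
        refine le_antisymm (iSup₂_le fun u hu => ?_) (iSup₂_le fun p hp => ?_)
        · exact le_iSup₂ (f := fun (p : WeakDual ℝ X × ℝ) (_ : p ∈ {p ∈ G | p.2 ≤ 0}) =>
            ((p.1 x : ℝ) : EReal)) (u, 0) ((hiff _).2 ⟨rfl, hu⟩)
        · exact le_iSup₂ (f := fun (u : WeakDual ℝ X) (_ : u ∈ {u | Persp.conj φ u = 0}) =>
            ((u x : ℝ) : EReal)) p.1 ((hiff p).1 hp).2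
      have hmem : (u₀, (0 : ℝ)) ∈ {p ∈ G | p.2 ≤ 0} := (hiff _).2 ⟨rfl, hu₀⟩
      rw [hsup, Persp.partialPersp_eq_add_indicatorFun ⟨_, hmem⟩ fun p hp => ((hiff p).1 hp).1]
    · intro hpos hne x y
      rw [hP]
      rcases Persp.scaleEnv_one_cases hne y with ⟨hD, -⟩ | ⟨β, hβ, hD, hy⟩
      · obtain ⟨p, hp, hp0⟩ := hposG hpos
        rw [Persp.partialPersp_eq_top hp (Persp.scaleEnv_eq_top_of_pos hp0 hD)]
        simp [hD]
      · have hQ := fun p (hp : p ∈ G) => Persp.scaleEnv_of_nonneg (hG0 p hp) hy hD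
        rw [hD]
        refine ⟨⟨EReal.bot_lt_coe _, .inl (by exact_mod_cast neg_nonpos.2 hβ)⟩, ?_⟩
        rcases hβ.eq_or_lt with rfl | hβ
        · rw [Persp.partialPersp_eq_recFun (G := G) hφt subset_rfl hGne
            fun p hp => by simp [hQ p hp]]
          simp
        · rw [Persp.partialPersp_eq_scaled hβ hQ, if_pos, EReal.coe_neg, neg_neg]
          exact ⟨EReal.bot_lt_coe _, by exact_mod_cast neg_neg_of_pos hβ⟩
  · intro hneg hpos
    have hn := hnegG hneg
    have hp := hposG hpos
    have hH : Persp.huberPart φ = Persp.affSup {p ∈ G | p.2 ≤ 0} := by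
      rw [Persp.huberPart_eq_affSup hφt, Persp.affSup_nonpos_eq_affSup_neg hφt hn]
    have hB : Persp.berhuPart φ = Persp.affSup {p ∈ G | 0 < p.2} :=
      Persp.berhuPart_eq_affSup hφt
    have hGnne : {p ∈ G | p.2 ≤ 0}.Nonempty := hn.imp fun p hp => ⟨hp.1, hp.2.le⟩
    have hGpne : {p ∈ G | 0 < p.2}.Nonempty := hp
    rw [hH, hB]
    -- Points of the graph of `φ*` give affine minorants of the two parts, and conversely both
    -- parts are at most `φ`; this compares the three perspectives without further conjugates.
    have hPH : ∀ x y, Persp.partialPersp {p ∈ G | p.2 ≤ 0} s x y ≤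
        Persp.perspective (Persp.affSup {p ∈ G | p.2 ≤ 0}) s (x, y) := fun x y =>
      iSup₂_le fun p hp => Persp.add_scaleEnv_le_perspective (Persp.le_affSup hp) s x y
    have hPB : ∀ x y, Persp.partialPersp {p ∈ G | 0 < p.2} s x y ≤
        Persp.perspective (Persp.affSup {p ∈ G | 0 < p.2}) s (x, y) := fun x y =>
      iSup₂_le fun p hp => Persp.add_scaleEnv_le_perspective (Persp.le_affSup hp) s x y
    refine ⟨fun x y => le_antisymm ?_ (max_le ?_ ?_), ?_, ?_⟩
    · rw [hP, hG, Persp.partialPersp_eq_max]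
      exact max_le_max (hPH x y) (hPB x y)
    · exact Persp.perspective_mono (Persp.affSup_le hGn) s _
    · exact Persp.perspective_mono (Persp.affSup_le hGp) s _
    · intro hempty
      refine ⟨fun ⟨x, y⟩ => ?_, fun x y => ⟨Persp.scaleEnv_nonneg s (by norm_num) y, ?_⟩⟩
      · refine (Persp.perspective_mono (Persp.affSup_le hGp) s _).trans ?_
        rw [hP, hG, Persp.partialPersp_eq_nonpos hempty]
        exact hPH x y
      · rw [hP]
        rcases Persp.scaleEnv_neg_one_cases s y with ha | ⟨α, hα, ha, hy⟩
        · obtain ⟨p, hp, hp0⟩ := hn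
          rw [Persp.partialPersp_eq_top hp (Persp.scaleEnv_eq_top_of_neg hp0 ha)]
          simp [ha]
        · rw [hG, Persp.partialPersp_eq_nonpos hempty, ← hG]
          have hQ := fun p (hp : p ∈ {p ∈ G | p.2 ≤ 0}) => Persp.scaleEnv_of_nonpos hp.2 hy ha
          rw [ha]
          rcases hα.eq_or_lt with rfl | hα
          · rw [Persp.partialPersp_eq_recFun hφt hGn hGnne fun p hp => by simp [hQ p hp]]
            simp
          · rw [Persp.partialPersp_eq_scaled hα hQ, if_pos]
            exact ⟨by exact_mod_cast hα, EReal.coe_lt_top α⟩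
    · intro hne x y
      rw [hP]
      rcases Persp.scaleEnv_neg_one_cases s y with ha | ⟨α, hα, ha, hy⟩
      · have hbot : ⊥ < Persp.scaleEnv s 1 y := by
          obtain ⟨w, hw⟩ := hne
          exact (EReal.bot_lt_coe _).trans_le (Persp.le_scaleEnv hw y)
        obtain ⟨p, hp, hp0⟩ := hn
        rw [Persp.partialPersp_eq_top hp (Persp.scaleEnv_eq_top_of_neg hp0 ha)]
        simp [ha, hbot]
      · rcases Persp.scaleEnv_one_cases hne y with ⟨-, ht⟩ | ⟨β, hβ, hD, -⟩
        · exact absurd (ha.symm.trans ht) (EReal.coe_ne_top α)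
        -- Here `s^▲ y = α`, `(-s)^▼ y = -β`, and `y` lies in the closed convex hull of `S`.
        have hαβ : α ≤ β := by
          have := Persp.scaleEnv_neg_one_le hy
          rw [ha, hD, ← EReal.coe_neg, neg_neg] at this
          exact_mod_cast this
        have hQn := fun p (hp : p ∈ {p ∈ G | p.2 ≤ 0}) => Persp.scaleEnv_of_nonpos hp.2 hy ha
        have hQp := fun p (hp : p ∈ {p ∈ G | 0 < p.2}) => Persp.scaleEnv_of_nonneg hp.2.le hy hD
        have hβ_neg : 0 < β → ((-β : ℝ) : EReal) < 0 := fun h0 => by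
          exact_mod_cast neg_neg_of_pos h0
        rw [ha, hD]
        refine ⟨EReal.bot_lt_coe _, fun h1 => hβ_neg ((EReal.coe_pos.1 h1.1).trans_le hαβ), ?_⟩
        rcases hα.eq_or_lt with rfl | hα
        · rcases hβ.eq_or_lt with rfl | hβ
          · have hQ : ∀ p ∈ G, Persp.scaleEnv s p.2 y = 0 := fun p hp => by
              rcases le_or_gt p.2 0 with h0 | h0
              · simpa using hQn p ⟨hp, h0⟩
              · simpa using hQp p ⟨hp, h0⟩
            rw [Persp.partialPersp_eq_recFun (G := G) hφt subset_rfl hGne hQ]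
            simp
          · rw [hG, Persp.partialPersp_eq_max, ← hG, Persp.partialPersp_eq_scaled hβ hQp,
              Persp.partialPersp_eq_recFun hφt hGn hGnne fun p hp => by simp [hQn p hp]]
            rw [if_neg (by simp), if_pos ⟨hβ_neg hβ, EReal.coe_zero⟩, EReal.coe_neg, neg_neg]
        · rw [hG, Persp.partialPersp_eq_max, ← hG, Persp.partialPersp_eq_scaled hα hQn,
            Persp.partialPersp_eq_scaled (hα.trans_le hαβ) hQp, if_pos, EReal.coe_neg,
            neg_neg]
          exact ⟨EReal.coe_pos.2 hα, EReal.coe_lt_top α⟩
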